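/- Let $d\ge 1$, let $A,B$ be finite sets with probability vectors $p=(p_a)_{a\in A}$ and $q=(q_b)_{b\in B}$, and let $X\sim(A^{\mathbb Z^d},\mu)$ and $Y\sim(B^{\mathbb Z^d},\nu)$ be the i.i.d. $\mathbb Z^d$-processes with $\mu=p^{\mathbb Z^d}$, $\nu=q^{\mathbb Z^d}$. Assume they have equal entropy: $-\sum_{a\in A}p_a\log p_a=-\sum_{b\in B}q_b\log q_b$ (with $0\log 0=0$). Let $\varphi:(A^{\mathbb Z^d},\mu)\to(B^{\mathbb Z^d},\nu)$ be a factor map, that is, a measurable map with $\varphi_*\mu=\nu$ that commutes $\mu$-almost everywhere with every translation of $\mathbb Z^d$. Its coding radius is $$R_\varphi(x)=\min\{n\in\mathbb N\cup\{\infty\}:\ \text{for $\mu$-a.e. }a,\ (a_i)_{i\in[-n,n]^d}=(x_i)_{i\in[-n,n]^d}\Rightarrow\varphi(a)_0=\varphi(x)_0\}.$$ Suppose that $\varphi$ is finitary, i.e. $R_\varphi<\infty$ $\mu$-a.s., and that $\mathbf E_\mu[R_\varphi^{d/2}]<\infty$. Then the information functions $I_p(a)=\log p_a^{-1}$ and $I_q(b)=\log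 q_b^{-1}$ satisfy $$\operatorname{Var}(I_p(X_0))=\operatorname{Var}(I_q(Y_0)).$$ -/

import Mathlib

open MeasureTheory ProbabilityTheory
open scoped ENNReal

noncomputable section

namespace FinitaryFactor

/-- Configurations on the lattice `ℤ^d` with symbols in `A`. -/
abbrev Config (d : ℕ) (A : Type*) : Type _ := (Fin d → ℤ) → A

/-- The translation `x ↦ (v ↦ x (v + u))` of configurations. -/
def shift {d : ℕ} {A : Type*} (u : Fin d → ℤ) (x : Config d A) : Config d A :=
  fun v => x (v + u)

/-- The law of the i.i.d. `ℤ^d`-process with marginal `p`: the product measure `p^{ℤ^d}`. -/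
def iidLaw (d : ℕ) {A : Type*} [MeasurableSpace A] (p : Measure A) : Measure (Config d A) :=
  Measure.infinitePi (fun _ : Fin d → ℤ => p)

/-- The information function `I_p(a) = log (1 / p_a)`. -/
def information {A : Type*} [MeasurableSpace A] (p : Measure A) (a : A) : ℝ :=
  Real.log (p.real {a})⁻¹

/-- The entropy `-∑ p_a log p_a` of the i.i.d. process with marginal `p`, with `0 log 0 = 0`. -/
def entropy {A : Type*} [Fintype A] [MeasurableSpace A] (p : Measure A) : ℝ :=
  -∑ a, p.real {a} * Real.log (p.real {a})

/-- A factor map (homomorphism) between shift-invariant measures: measure preserving,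
and commuting with every translation almost everywhere. -/
structure IsFactorMap {d : ℕ} {A B : Type*} [MeasurableSpace A] [MeasurableSpace B]
    (μ : Measure (Config d A)) (ν : Measure (Config d B)) (φ : Config d A → Config d B) :
    Prop where
  measurePreserving : MeasurePreserving φ μ ν
  equivariant : ∀ u : Fin d → ℤ, ∀ᵐ x ∂μ, φ (shift u x) = shift u (φ x)

/-- The cube `B(0,n) = [-n,n]^d` in `ℤ^d`. -/
def cube (d n : ℕ) : Set (Fin d → ℤ) := {i | ∀ k, |i k| ≤ (n : ℤ)}

/-- `x` restricted to `B(0,n)` determines the symbol at the origin of the image, up to null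
sets. -/
def Determines {d : ℕ} {A B : Type*} [MeasurableSpace A] (μ : Measure (Config d A))
    (φ : Config d A → Config d B) (x : Config d A) (n : ℕ) : Prop :=
  ∀ᵐ a ∂μ, (∀ i ∈ cube d n, a i = x i) → φ a 0 = φ x 0

/-- The coding radius: the least `n` such that `x` on `B(0,n)` determines `φ(x)_0`,
and `⊤` if there is none. -/
def codingRadius {d : ℕ} {A B : Type*} [MeasurableSpace A] (μ : Measure (Config d A))
    (φ : Config d A → Config d B) (x : Config d A) : ℕ∞ :=
  ⨅ (n : ℕ) (_ : Determines μ φ x n), (n : ℕ∞)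

/-- The map is finitary: its coding radius is almost surely finite. -/
def IsFinitary {d : ℕ} {A B : Type*} [MeasurableSpace A] (μ : Measure (Config d A))
    (φ : Config d A → Config d B) : Prop :=
  ∀ᵐ x ∂μ, codingRadius μ φ x < ⊤

/-- The moment `E[R_φ ^ α]` of the coding radius, as an extended nonnegative number. -/
def codingMoment {d : ℕ} {A B : Type*} [MeasurableSpace A] (μ : Measure (Config d A))
    (φ : Config d A → Config d B) (α : ℝ) : ℝ≥0∞ :=
  ∫⁻ x, (codingRadius μ φ x : ℝ≥0∞) ^ α ∂μ

end FinitaryFactor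

end

/-
Let `S` and `T` be the centred information sums of `x` and of `φ x` over a box of side `n`, so
that `E S² = n^d Var I_p` and `E T² = n^d Var I_q`; the difference of the variances is then
`n^{-d} E[(S + T)(S - T)]`. Replacing the symbols of `φ x` by what is forced by the patterns of `x`
of radius `m` turns `T` into a local function `Q` with `E|T - Q| = O(n^d P(R > m))`. A pattern of
`x` has at most the probability of the pattern of `φ x` that it forces, so `Q ≤ S` up to a boundary
term. Applied to a large union of boxes whose inner parts are reweighted independently by a density
`W`, this gives `E[(S - Q) W] ≥ 0`: the boundary term disappears in the limit. With `W = b ± ψ` and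
`E S = E T = 0`, it follows that `|E[ψ (S - T)]| = O(n^d P(R > m))` uniformly over local `ψ`
bounded by `1`. Take for `ψ` a multiple of `S + Q` truncated at the scale `n^{d/2}` and `n = k m`
with `k` large: the difference of the variances is small, up to a function of `m^{d/2} P(R > m)`
that vanishes with it, and `m^{d/2} P(R > m) → 0` because `E R^{d/2} < ∞`.
-/

noncomputable section

namespace FinitaryFactor

open Filter Topology

section L2

variable {α : Type*} [MeasurableSpace α] {μ : Measure α}

lemma abs_norm_sq_sub_norm_sq_le {E : Type*} [NormedAddCommGroup E] [InnerProductSpace ℝ E]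
    (x x' y y' : E) :
    |‖x‖ ^ 2 - ‖y‖ ^ 2| ≤
      (‖x - x'‖ + ‖y - y'‖) * (‖x‖ + ‖y‖) + |inner ℝ (x' + y') (x - y)| := by
  have hsplit : ‖x‖ ^ 2 - ‖y‖ ^ 2 =
      inner ℝ ((x - x') + (y - y')) (x - y) + inner ℝ (x' + y') (x - y) := by
    rw [← inner_add_left, show (x - x') + (y - y') + (x' + y') = x + y by abel, inner_add_left,
      inner_sub_right, inner_sub_right, real_inner_self_eq_norm_sq, real_inner_self_eq_norm_sq,
      real_inner_comm]
    ring
  rw [hsplit]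
  refine (abs_add_le _ _).trans (add_le_add_left ((abs_real_inner_le_norm _ _).trans ?_) _)
  gcongr
  exacts [norm_add_le _ _, norm_sub_le _ _]

lemma norm_toLp_eq_lpNorm {p : ℝ≥0∞} {f : α → ℝ} (hf : MemLp f p μ) :
    ‖hf.toLp f‖ = lpNorm f p μ := by
  rw [Lp.norm_toLp, toReal_eLpNorm hf.aestronglyMeasurable]

lemma inner_toLp_two {f g : α → ℝ} (hf : MemLp f 2 μ) (hg : MemLp g 2 μ) :
    inner ℝ (hf.toLp f) (hg.toLp g) = ∫ x, f x * g x ∂μ := by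
  rw [L2.inner_def]
  refine integral_congr_ae ?_
  filter_upwards [hf.coeFn_toLp, hg.coeFn_toLp] with x hfx hgx
  simp [hfx, hgx, mul_comm]

lemma lpNorm_two_sq {f : α → ℝ} (hf : MemLp f 2 μ) : lpNorm f 2 μ ^ 2 = ∫ x, f x ^ 2 ∂μ := by
  simp_rw [← norm_toLp_eq_lpNorm hf, ← real_inner_self_eq_norm_sq, inner_toLp_two hf hf, pow_two]

lemma lpNorm_two_le_of_integral_sq_le {f : α → ℝ} (hf : MemLp f 2 μ) {c : ℝ}
    (h : ∫ x, f x ^ 2 ∂μ ≤ c) : lpNorm f 2 μ ≤ √c :=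
  Real.le_sqrt_of_sq_le (lpNorm_two_sq hf ▸ h)

lemma abs_lpNorm_sq_sub_lpNorm_sq_le {f f' g g' : α → ℝ} (hf : MemLp f 2 μ) (hf' : MemLp f' 2 μ)
    (hg : MemLp g 2 μ) (hg' : MemLp g' 2 μ) :
    |lpNorm f 2 μ ^ 2 - lpNorm g 2 μ ^ 2| ≤
      (lpNorm (f - f') 2 μ + lpNorm (g - g') 2 μ) * (lpNorm f 2 μ + lpNorm g 2 μ) +
        |∫ x, (f' + g') x * (f - g) x ∂μ| := by
  simpa only [← MemLp.toLp_sub, ← MemLp.toLp_add, norm_toLp_eq_lpNorm, inner_toLp_two] using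
    abs_norm_sq_sub_norm_sq_le (hf.toLp f) (hf'.toLp f') (hg.toLp g) (hg'.toLp g')

end L2

lemma abs_integral_mul_le_mul_integral_abs {α : Type*} [MeasurableSpace α] {μ : Measure α}
    {f g : α → ℝ} {b : ℝ} (hf : ∀ x, |f x| ≤ b) (hg : Integrable g μ) :
    |∫ x, f x * g x ∂μ| ≤ b * ∫ x, |g x| ∂μ := by
  rw [← integral_const_mul]
  refine abs_integral_le_integral_abs.trans (integral_mono_of_nonneg
    (.of_forall fun _ => abs_nonneg _) (hg.abs.const_mul b) (.of_forall fun x => ?_))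
  simp only [abs_mul]
  exact mul_le_mul_of_nonneg_right (hf x) (abs_nonneg _)

section Clip

/-- The truncation of a real number to the interval `[-r, r]`, for `0 ≤ r`. -/
def clip (r w : ℝ) : ℝ := max (-r) (min w r)

variable {r : ℝ}

lemma abs_clip_le (hr : 0 ≤ r) (w : ℝ) : |clip r w| ≤ r :=
  abs_le.2 ⟨le_max_left _ _, max_le (by linarith) (min_le_right _ _)⟩

lemma abs_clip_sub_clip_le (r u w : ℝ) : |clip r u - clip r w| ≤ |u - w| :=
  calc |clip r u - clip r w| ≤ max |-r - -r| |min u r - min w r| := abs_max_sub_max_le_max _ _ _ _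
    _ ≤ |u - w| := by simpa using abs_min_sub_min_le_max u r w r

lemma clip_sub_clip_sq_le (hr : 0 ≤ r) (u w : ℝ) :
    (clip r u - clip r w) ^ 2 ≤ 2 * r * |u - w| := by
  have hdiam : |clip r u - clip r w| ≤ 2 * r :=
    (abs_sub _ _).trans (by linarith [abs_clip_le hr u, abs_clip_le hr w])
  rw [← sq_abs, pow_two]
  exact mul_le_mul hdiam (abs_clip_sub_clip_le r u w) (abs_nonneg _) (by positivity)

lemma abs_sub_clip (hr : 0 ≤ r) (w : ℝ) : |w - clip r w| = max (|w| - r) 0 := by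
  unfold clip
  grind

lemma sub_clip_sq_le (hr : 0 < r) {t : ℝ} (ht : 0 ≤ t) (w : ℝ) :
    (w - clip (t * r) w) ^ 2 ≤
      2 * r ^ 2 * Real.exp (-t) * (Real.exp (w / r) + Real.exp (-(w / r))) := by
  rw [← sq_abs, abs_sub_clip (mul_nonneg ht hr.le)]
  set u := |w| / r - t with hu
  have hscale : |w| - t * r = r * u := by rw [hu]; field_simp
  have hexp : max u 0 ^ 2 ≤ 2 * Real.exp u := by
    rcases le_total u 0 with h | h
    · rw [max_eq_right h]
      simpa using (Real.exp_pos u).le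
    · rw [max_eq_left h]
      linarith [Real.quadratic_le_exp_of_nonneg h]
  have habs : Real.exp (|w| / r) ≤ Real.exp (w / r) + Real.exp (-(w / r)) := by
    rw [← abs_of_pos hr, ← abs_div, abs_of_pos hr]
    exact Real.exp_abs_le _
  calc max (|w| - t * r) 0 ^ 2 = r ^ 2 * max u 0 ^ 2 := by
        rw [hscale, ← mul_zero r, ← mul_max_of_nonneg _ _ hr.le, mul_zero, mul_pow]
    _ ≤ r ^ 2 * (2 * Real.exp u) := by gcongr
    _ = 2 * r ^ 2 * Real.exp (-t) * Real.exp (|w| / r) := by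
        rw [hu, sub_eq_neg_add, Real.exp_add]
        ring
    _ ≤ _ := by gcongr

end Clip

section Local

variable {ι A : Type*}

/-- A local function of a configuration: one that depends on finitely many coordinates only. -/
def IsLocal {β : Type*} (f : (ι → A) → β) : Prop := ∃ s : Finset ι, DependsOn f (s : Set ι)

namespace IsLocal

variable {β γ δ : Type*} {f g : (ι → A) → ℝ}

lemma comp_apply (h : A → β) (i : ι) : IsLocal fun x : ι → A => h (x i) :=
  ⟨{i}, fun x y hxy => congrArg h (hxy i (by simp))⟩

lemma comp {f : (ι → A) → β} (h : β → γ) (hf : IsLocal f) : IsLocal fun x => h (f x) :=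
  let ⟨s, hs⟩ := hf
  ⟨s, fun _ _ hxy => congrArg h (hs hxy)⟩

lemma comp₂ {f : (ι → A) → β} {g : (ι → A) → γ} (op : β → γ → δ) (hf : IsLocal f)
    (hg : IsLocal g) : IsLocal fun x => op (f x) (g x) := by
  classical
  obtain ⟨s, hs⟩ := hf
  obtain ⟨t, ht⟩ := hg
  exact ⟨s ∪ t, fun x y hxy => congrArg₂ op (hs fun i hi => hxy i (by simp_all))
    (ht fun i hi => hxy i (by simp_all))⟩

lemma sub (hf : IsLocal f) (hg : IsLocal g) : IsLocal (f - g) := hf.comp₂ (· - ·) hg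

lemma mul (hf : IsLocal f) (hg : IsLocal g) : IsLocal fun x => f x * g x := hf.comp₂ (· * ·) hg

lemma sum {κ : Type*} {J : Finset κ} {F : κ → (ι → A) → ℝ} (hF : ∀ j ∈ J, IsLocal (F j)) :
    IsLocal fun x => ∑ j ∈ J, F j x := by
  classical
  choose! s hs using hF
  exact ⟨J.biUnion s, fun x y hxy => Finset.sum_congr rfl fun j hj =>
    hs j hj fun i hi => hxy i (by simpa using ⟨j, hj, hi⟩)⟩

lemma prod {κ : Type*} {J : Finset κ} {F : κ → (ι → A) → ℝ} (hF : ∀ j ∈ J, IsLocal (F j)) :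
    IsLocal fun x => ∏ j ∈ J, F j x := by
  classical
  choose! s hs using hF
  exact ⟨J.biUnion s, fun x y hxy => Finset.prod_congr rfl fun j hj =>
    hs j hj fun i hi => hxy i (by simpa using ⟨j, hj, hi⟩)⟩

section Measure

variable [Finite A] [MeasurableSpace A] [MeasurableSingletonClass A]

lemma measurable (hf : IsLocal f) : Measurable f := by
  obtain ⟨s, hs⟩ := hf
  obtain ⟨g, rfl⟩ := dependsOn_iff_exists_comp.1 hs
  exact (measurable_of_finite g).comp (Finset.measurable_restrict s)

variable (μ : Measure (ι → A))

lemma memLp [IsFiniteMeasure μ] (hf : IsLocal f) (r : ℝ≥0∞) : MemLp f r μ := by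
  have hm := hf.measurable
  obtain ⟨s, hs⟩ := hf
  obtain ⟨g, rfl⟩ := dependsOn_iff_exists_comp.1 hs
  obtain ⟨C, hC⟩ := (Set.finite_range fun w => ‖g w‖).bddAbove
  exact .of_bound hm.aestronglyMeasurable C (.of_forall fun x => hC ⟨_, rfl⟩)

lemma integrable [IsFiniteMeasure μ] (hf : IsLocal f) : Integrable f μ :=
  memLp_one_iff_integrable.1 (hf.memLp μ 1)

end Measure

end IsLocal

section Independence

variable [Finite A] [MeasurableSpace A] [MeasurableSingletonClass A]
  (P : ι → Measure A) [∀ i, IsProbabilityMeasure (P i)]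

lemma integral_mul_of_dependsOn {f g : (ι → A) → ℝ} {s t : Finset ι} (hst : Disjoint s t)
    (hf : DependsOn f (s : Set ι)) (hg : DependsOn g (t : Set ι)) :
    ∫ x, f x * g x ∂Measure.infinitePi P =
      (∫ x, f x ∂Measure.infinitePi P) * ∫ x, g x ∂Measure.infinitePi P := by
  have hfm := IsLocal.measurable ⟨s, hf⟩
  have hgm := IsLocal.measurable ⟨t, hg⟩
  obtain ⟨f', rfl⟩ := dependsOn_iff_exists_comp.1 hf
  obtain ⟨g', rfl⟩ := dependsOn_iff_exists_comp.1 hg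
  have hind : iIndepFun (fun (i : ι) (x : ι → A) => x i) (Measure.infinitePi P) :=
    iIndepFun_infinitePi (X := fun _ a => a) fun _ => measurable_id
  exact ((hind.indepFun_finset s t hst measurable_pi_apply).comp
    (measurable_of_finite f') (measurable_of_finite g')).integral_fun_mul_eq_mul_integral
      hfm.aestronglyMeasurable hgm.aestronglyMeasurable

lemma integral_prod_of_dependsOn {κ : Type*} {J : Finset κ} {g : κ → (ι → A) → ℝ}
    {s : κ → Finset ι} (hs : (J : Set κ).PairwiseDisjoint s)
    (hg : ∀ j ∈ J, DependsOn (g j) (s j : Set ι)) :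
    ∫ x, ∏ j ∈ J, g j x ∂Measure.infinitePi P = ∏ j ∈ J, ∫ x, g j x ∂Measure.infinitePi P := by
  classical
  induction J using Finset.induction_on with
  | empty => simp
  | insert j J hj ih =>
    rw [Finset.coe_insert, Set.pairwiseDisjoint_insert_of_notMem (by simpa using hj)] at hs
    rw [Finset.forall_mem_insert] at hg
    have hrest : DependsOn (fun x => ∏ k ∈ J, g k x) (J.biUnion s : Set ι) :=
      fun x y hxy => Finset.prod_congr rfl fun k hk =>
        hg.2 k hk fun i hi => hxy i (by simpa using ⟨k, hk, hi⟩)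
    simp_rw [Finset.prod_insert hj, ← ih hs.1 hg.2]
    exact integral_mul_of_dependsOn P ((Finset.disjoint_biUnion_right _ _ _).2 hs.2) hg.1 hrest

end Independence

end Local

section Box

variable {d : ℕ}

/-- The box `[lo, hi)^d` of `ℤ^d`, which is empty when `hi ≤ lo` and `d ≠ 0`. -/
def box (d : ℕ) (lo hi : ℤ) : Finset (Fin d → ℤ) := Fintype.piFinset fun _ => Finset.Ico lo hi

lemma mem_box {lo hi : ℤ} {v : Fin d → ℤ} : v ∈ box d lo hi ↔ ∀ l, lo ≤ v l ∧ v l < hi := by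
  simp [box]

lemma card_box {lo hi : ℤ} (h : lo ≤ hi) : ((box d lo hi).card : ℝ) = ((hi : ℝ) - lo) ^ d := by
  have hcast : ((hi - lo).toNat : ℝ) = hi - lo := by
    exact_mod_cast Int.toNat_of_nonneg (sub_nonneg.2 h)
  simp [box, hcast]

lemma box_subset_box {lo hi lo' hi' : ℤ} (h : lo' ≤ lo) (h' : hi ≤ hi') :
    box d lo hi ⊆ box d lo' hi' := fun _ hv =>
  mem_box.2 fun l => ⟨h.trans (mem_box.1 hv l).1, (mem_box.1 hv l).2.trans_le h'⟩

lemma coe_box_eq_cube (d m : ℕ) : (box d (-m) (m + 1) : Set (Fin d → ℤ)) = cube d m := by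
  ext v
  simp only [Finset.mem_coe, mem_box, cube, Set.mem_ofPred_eq, abs_le, Int.lt_add_one_iff]

lemma add_mem_box_of_mem_cube {m : ℕ} {lo hi : ℤ} {i v : Fin d → ℤ} (hi' : i ∈ cube d m)
    (hv : v ∈ box d lo hi) : i + v ∈ box d (lo - m) (hi + m) := by
  refine mem_box.2 fun l => ?_
  have hil := abs_le.1 (hi' l)
  have hvl := mem_box.1 hv l
  simp only [Pi.add_apply]
  omega

lemma sum_box_tiling {R : Type*} [AddCommMonoid R] {M n : ℕ} (g : (Fin d → ℤ) → R) :
    ∑ j ∈ box d 0 M, ∑ v ∈ box d 0 n, g (v + (n : ℤ) • j) = ∑ v ∈ box d 0 (M * n), g v := by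
  rw [← Finset.sum_product']
  refine Finset.sum_nbij' (fun jv => jv.2 + (n : ℤ) • jv.1)
    (fun u => (fun l => u l / n, fun l => u l % n)) ?_ ?_ ?_ ?_ fun _ _ => rfl
  · rintro ⟨j, v⟩ hjv
    simp only [Finset.mem_product, mem_box, Pi.add_apply, Pi.smul_apply, smul_eq_mul] at hjv ⊢
    intro l
    obtain ⟨hj, hv⟩ := hjv.1 l, hjv.2 l
    constructor <;> nlinarith
  · intro u hu
    simp only [Finset.mem_product, mem_box] at hu ⊢
    have hn : ∀ _ : Fin d, (0 : ℤ) < n := fun l => by nlinarith [hu l]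
    exact ⟨fun l => ⟨Int.ediv_nonneg (hu l).1 (hn l).le,
      Int.ediv_lt_of_lt_mul (hn l) (hu l).2⟩,
      fun l => ⟨Int.emod_nonneg _ (hn l).ne', Int.emod_lt_of_pos _ (hn l)⟩⟩
  · rintro ⟨j, v⟩ hjv
    simp only [Finset.mem_product, mem_box] at hjv
    have hquot : ∀ l, (v l + n * j l) / n = j l := fun l => by
      obtain ⟨h0, hn⟩ := hjv.2 l
      rw [Int.add_mul_ediv_left _ _ (h0.trans_lt hn).ne', Int.ediv_eq_zero_of_lt h0 hn, zero_add]
    ext l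
    · simp [hquot]
    · simp [Int.emod_eq_of_lt (hjv.2 l).1 (hjv.2 l).2]
  · intro u _
    ext l
    simp [Int.emod_add_mul_ediv]

end Box

section Shift

variable {d : ℕ} {A : Type*}

lemma shift_shift (u v : Fin d → ℤ) (x : Config d A) : shift u (shift v x) = shift (u + v) x := by
  ext i
  simp [shift, add_assoc]

lemma dependsOn_comp_shift {β : Type*} {f : Config d A → β} {s : Finset (Fin d → ℤ)}
    (hf : DependsOn f (s : Set (Fin d → ℤ))) (u : Fin d → ℤ) :
    DependsOn (fun x => f (shift u x)) (s.map (addRightEmbedding u) : Set (Fin d → ℤ)) :=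
  fun _ _ hxy => hf fun i hi => hxy _ (by simpa using hi)

lemma IsLocal.comp_shift {β : Type*} {f : Config d A → β} (hf : IsLocal f) (u : Fin d → ℤ) :
    IsLocal fun x => f (shift u x) :=
  let ⟨_, hs⟩ := hf
  ⟨_, dependsOn_comp_shift hs u⟩

variable [MeasurableSpace A] (p : Measure A) [IsProbabilityMeasure p]

instance isProbabilityMeasure_iidLaw : IsProbabilityMeasure (iidLaw d p) := by
  unfold iidLaw
  infer_instance

lemma measurePreserving_shift (u : Fin d → ℤ) :
    MeasurePreserving (shift u) (iidLaw d p) (iidLaw d p) :=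
  ⟨measurable_pi_lambda _ fun _ => measurable_pi_apply _,
    Measure.map_infinitePi_infinitePi_of_inj (add_left_injective u)⟩

end Shift

lemma integral_comp_measurePreserving {α β : Type*} [MeasurableSpace α] [MeasurableSpace β]
    {μ : Measure α} {ν : Measure β} {f : α → β} (hf : MeasurePreserving f μ ν) {g : β → ℝ}
    (hg : AEStronglyMeasurable g ν) : ∫ x, g (f x) ∂μ = ∫ y, g y ∂ν := by
  rw [← hf.map_eq] at hg ⊢
  exact (integral_map hf.measurable.aemeasurable hg).symm

lemma lpNorm_comp_measurePreserving {α β : Type*} [MeasurableSpace α] [MeasurableSpace β]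
    {μ : Measure α} {ν : Measure β} {f : α → β} (hf : MeasurePreserving f μ ν) {g : β → ℝ}
    (hg : AEStronglyMeasurable g ν) (r : ℝ≥0∞) : lpNorm (g ∘ f) r μ = lpNorm g r ν := by
  rw [← toReal_eLpNorm hg, ← toReal_eLpNorm (hg.comp_measurePreserving hf),
    eLpNorm_comp_measurePreserving hg hf]

section Reweighting

variable {d : ℕ} {A : Type*} [Finite A] [MeasurableSpace A] [MeasurableSingletonClass A]
  (p : Measure A) [IsProbabilityMeasure p] {F L : Config d A → ℝ} {E Λ : Finset (Fin d → ℤ)}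

lemma IsLocal.integral_comp_shift (hF : IsLocal F) (u : Fin d → ℤ) :
    ∫ x, F (shift u x) ∂iidLaw d p = ∫ x, F x ∂iidLaw d p :=
  integral_comp_measurePreserving (measurePreserving_shift p u) hF.measurable.aestronglyMeasurable

lemma integral_comp_shift_mul_prod {κ : Type*} {J : Finset κ} {u : κ → Fin d → ℤ}
    (hF : DependsOn F (E : Set (Fin d → ℤ))) (hL : DependsOn L (Λ : Set (Fin d → ℤ)))
    (hΛE : Λ ⊆ E) (hL1 : ∫ x, L x ∂iidLaw d p = 1)
    (hsep : ∀ j ∈ J, ∀ k ∈ J, j ≠ k →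
      Disjoint (E.map (addRightEmbedding (u j))) (Λ.map (addRightEmbedding (u k))))
    {j : κ} (hj : j ∈ J) :
    ∫ x, F (shift (u j) x) * ∏ k ∈ J, L (shift (u k) x) ∂iidLaw d p =
      ∫ x, F x * L x ∂iidLaw d p := by
  classical
  have hFL : DependsOn (fun x => F x * L x) (E : Set (Fin d → ℤ)) := fun x y hxy =>
    congrArg₂ _ (hF hxy) (hL fun i hi => hxy i (hΛE hi))
  have hrest : DependsOn (fun x => ∏ k ∈ J.erase j, L (shift (u k) x))
      ((J.erase j).biUnion fun k => Λ.map (addRightEmbedding (u k)) : Set (Fin d → ℤ)) :=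
    fun x y hxy => Finset.prod_congr rfl fun k hk =>
      dependsOn_comp_shift hL (u k) fun i hi => hxy i (Finset.mem_biUnion.2 ⟨k, hk, hi⟩)
  have hdisj : Disjoint (E.map (addRightEmbedding (u j)))
      ((J.erase j).biUnion fun k => Λ.map (addRightEmbedding (u k))) :=
    (Finset.disjoint_biUnion_right _ _ _).2 fun k hk =>
      hsep j hj k (Finset.mem_of_mem_erase hk) (Finset.ne_of_mem_erase hk).symm
  have hpair : ((J.erase j : Finset κ) : Set κ).PairwiseDisjoint
      fun k => Λ.map (addRightEmbedding (u k)) := fun k hk l hl hkl =>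
    (hsep k (Finset.mem_of_mem_erase hk) l (Finset.mem_of_mem_erase hl) hkl).mono_left
      (Finset.map_subset_map.2 hΛE)
  calc ∫ x, F (shift (u j) x) * ∏ k ∈ J, L (shift (u k) x) ∂iidLaw d p
      = ∫ x, (F (shift (u j) x) * L (shift (u j) x)) *
          ∏ k ∈ J.erase j, L (shift (u k) x) ∂iidLaw d p := by
        congr 1 with x
        rw [mul_assoc, Finset.mul_prod_erase J (fun k => L (shift (u k) x)) hj]
    _ = (∫ x, F x * L x ∂iidLaw d p) * ∏ k ∈ J.erase j, ∫ x, L (shift (u k) x) ∂iidLaw d p := by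
        rw [← IsLocal.integral_comp_shift p ⟨E, hFL⟩ (u j), iidLaw,
          ← integral_prod_of_dependsOn _ hpair fun k _ => dependsOn_comp_shift hL (u k)]
        exact integral_mul_of_dependsOn _ hdisj (dependsOn_comp_shift hFL (u j)) hrest
    _ = ∫ x, F x * L x ∂iidLaw d p := by
        simp_rw [IsLocal.integral_comp_shift p ⟨Λ, hL⟩, hL1, Finset.prod_const_one, mul_one]

-- The product of the translates of `L` is a probability density which reweights the blocks
-- independently, so every translate of `F` has the same mean under it as `F` has under `L`.
lemma le_card_mul_integral_mul {κ : Type*} {J : Finset κ} {u : κ → Fin d → ℤ}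
    (hF : DependsOn F (E : Set (Fin d → ℤ))) (hL : DependsOn L (Λ : Set (Fin d → ℤ)))
    (hΛE : Λ ⊆ E) (hL0 : ∀ x, 0 ≤ L x) (hL1 : ∫ x, L x ∂iidLaw d p = 1)
    (hsep : ∀ j ∈ J, ∀ k ∈ J, j ≠ k →
      Disjoint (E.map (addRightEmbedding (u j))) (Λ.map (addRightEmbedding (u k))))
    {c : ℝ} (hc : ∀ᵐ x ∂iidLaw d p, c ≤ ∑ j ∈ J, F (shift (u j) x)) :
    c ≤ J.card * ∫ x, F x * L x ∂iidLaw d p := by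
  have hFloc : ∀ j, IsLocal fun x => F (shift (u j) x) := fun j => IsLocal.comp_shift ⟨E, hF⟩ (u j)
  let w : Config d A → ℝ := fun x => ∏ k ∈ J, L (shift (u k) x)
  have hwloc : IsLocal w := .prod fun k _ => IsLocal.comp_shift ⟨Λ, hL⟩ (u k)
  have hw1 : ∫ x, w x ∂iidLaw d p = 1 :=
    calc ∫ x, w x ∂iidLaw d p = ∏ k ∈ J, ∫ x, L (shift (u k) x) ∂iidLaw d p :=
          integral_prod_of_dependsOn _ (fun j hj k hk hjk => (hsep j hj k hk hjk).mono_left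
            (Finset.map_subset_map.2 hΛE)) fun k _ => dependsOn_comp_shift hL (u k)
      _ = 1 := by
          simp_rw [IsLocal.integral_comp_shift p ⟨Λ, hL⟩, hL1, Finset.prod_const_one]
  calc c = ∫ x, c * w x ∂iidLaw d p := by rw [integral_const_mul, hw1, mul_one]
    _ ≤ ∫ x, (∑ j ∈ J, F (shift (u j) x)) * w x ∂iidLaw d p :=
        integral_mono_ae ((hwloc.integrable _).const_mul c)
          (((IsLocal.sum fun j _ => hFloc j).mul hwloc).integrable _)
          (hc.mono fun x hx => mul_le_mul_of_nonneg_right hx (Finset.prod_nonneg fun _ _ => hL0 _))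
    _ = ∑ j ∈ J, ∫ x, F (shift (u j) x) * w x ∂iidLaw d p := by
        simp_rw [Finset.sum_mul]
        exact integral_finsetSum _ fun j _ => ((hFloc j).mul hwloc).integrable _
    _ = J.card * ∫ x, F x * L x ∂iidLaw d p := by
        rw [Finset.sum_congr rfl fun j hj => integral_comp_shift_mul_prod p hF hL hΛE hL1 hsep hj,
          Finset.sum_const, nsmul_eq_mul]

lemma integral_mul_nonneg_of_ae_le_sum_shift {n : ℕ} {c : ℕ → ℝ}
    (hF : DependsOn F (E : Set (Fin d → ℤ))) (hL : DependsOn L (Λ : Set (Fin d → ℤ)))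
    (hΛE : Λ ⊆ E) (hL0 : ∀ x, 0 ≤ L x)
    (hsep : ∀ j k : Fin d → ℤ, j ≠ k →
      Disjoint (E.map (addRightEmbedding ((n : ℤ) • j))) (Λ.map (addRightEmbedding ((n : ℤ) • k))))
    (hc : ∀ M : ℕ, ∀ᵐ x ∂iidLaw d p, c M ≤ ∑ j ∈ box d 0 M, F (shift ((n : ℤ) • j) x))
    (hlim : Tendsto (fun M : ℕ => c M / (M : ℝ) ^ d) atTop (𝓝 0)) :
    0 ≤ ∫ x, F x * L x ∂iidLaw d p := by
  set a := ∫ x, L x ∂iidLaw d p with ha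
  rcases (integral_nonneg hL0 : 0 ≤ a).eq_or_lt' with h0 | hpos
  · have hLae := (integral_eq_zero_iff_of_nonneg hL0 (IsLocal.integrable _ ⟨Λ, hL⟩)).1 h0
    exact (integral_eq_zero_of_ae (hLae.mono fun x hx => mul_eq_zero_of_right _ hx)).ge
  have hle : ∀ M : ℕ, 0 < M → c M / (M : ℝ) ^ d ≤ ∫ x, F x * (a⁻¹ * L x) ∂iidLaw d p := by
    intro M hM
    have hcard := le_card_mul_integral_mul p (L := fun x => a⁻¹ * L x) hF
      (fun x y hxy => congrArg _ (hL hxy)) hΛE (fun x => mul_nonneg (inv_nonneg.2 hpos.le) (hL0 x))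
      (by rw [integral_const_mul, ← ha, inv_mul_cancel₀ hpos.ne'])
      (fun j _ k _ => hsep j k) (hc M)
    rw [card_box (Int.natCast_nonneg M), Int.cast_natCast, Int.cast_zero, sub_zero] at hcard
    exact (div_le_iff₀' (by positivity)).2 hcard
  have hnonneg := le_of_tendsto hlim ((eventually_gt_atTop 0).mono hle)
  simp_rw [mul_left_comm _ a⁻¹, integral_const_mul] at hnonneg
  exact nonneg_of_mul_nonneg_right hnonneg (inv_pos.2 hpos)

end Reweighting

lemma integral_sub_clip_sq_le_of_hasSubgaussianMGF {Ω : Type*} [MeasurableSpace Ω]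
    {μ : Measure Ω} {X : Ω → ℝ} {c : NNReal} (hX : HasSubgaussianMGF X c μ) {C r t : ℝ}
    (hr : 0 < r) (ht : 0 ≤ t) (hc : c ≤ C * r ^ 2) :
    ∫ ω, (X ω - clip (t * r) (X ω)) ^ 2 ∂μ ≤ r ^ 2 * (4 * Real.exp (C / 2) * Real.exp (-t)) := by
  have hmgf : ∀ u : ℝ, u ^ 2 = (r ^ 2)⁻¹ → ∫ ω, Real.exp (u * X ω) ∂μ ≤ Real.exp (C / 2) := by
    refine fun u hu => (hX.mgf_le u).trans (Real.exp_le_exp.2 ?_)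
    rw [hu]
    gcongr
    exact (mul_inv_le_iff₀ (by positivity)).2 hc
  have hint := hX.integrable_exp_mul
  calc ∫ ω, (X ω - clip (t * r) (X ω)) ^ 2 ∂μ
      ≤ ∫ ω, 2 * r ^ 2 * Real.exp (-t) *
          (Real.exp (r⁻¹ * X ω) + Real.exp (-r⁻¹ * X ω)) ∂μ := by
        refine integral_mono_of_nonneg (.of_forall fun ω => sq_nonneg _)
          (((hint _).add (hint _)).const_mul _) (.of_forall fun ω => ?_)
        simpa only [neg_mul, ← div_eq_inv_mul] using sub_clip_sq_le hr ht (X ω)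
    _ ≤ 2 * r ^ 2 * Real.exp (-t) * (Real.exp (C / 2) + Real.exp (C / 2)) := by
        rw [integral_const_mul, integral_add (hint _) (hint _)]
        gcongr
        exacts [hmgf _ (inv_pow r 2), hmgf _ (by rw [neg_sq, inv_pow])]
    _ = r ^ 2 * (4 * Real.exp (C / 2) * Real.exp (-t)) := by ring

section Information

variable {A : Type*} [MeasurableSpace A] (p : Measure A)

lemma exists_information_le [Finite A] : ∃ K, ∀ a, information p a ≤ K :=
  let ⟨K, hK⟩ := (Set.finite_range (information p)).bddAbove
  ⟨K, fun a => hK ⟨a, rfl⟩⟩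

variable [IsProbabilityMeasure p]

lemma information_nonneg (a : A) : 0 ≤ information p a := by
  rw [information, Real.log_inv]
  exact neg_nonneg.2 (Real.log_nonpos measureReal_nonneg measureReal_le_one)

lemma integral_information [Fintype A] [MeasurableSingletonClass A] :
    ∫ a, information p a ∂p = entropy p := by
  rw [integral_fintype Integrable.of_finite]
  simp [information, entropy]

lemma ae_measureReal_singleton_ne_zero [Countable A] {d : ℕ} :
    ∀ᵐ x ∂iidLaw d p, ∀ i, p.real {x i} ≠ 0 := by
  have hp : ∀ᵐ a ∂p, p.real {a} ≠ 0 :=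
    ae_iff_of_countable.2 fun a ha => ENNReal.toReal_ne_zero.2 ⟨ha, measure_ne_top _ _⟩
  exact ae_all_iff.2 fun i =>
    (measurePreserving_eval_infinitePi (fun _ : Fin d → ℤ => p) i).quasiMeasurePreserving.ae hp

section Marginal

variable [Finite A] [MeasurableSingletonClass A] {d : ℕ}

lemma integral_comp_apply (f : A → ℝ) (v : Fin d → ℤ) :
    ∫ x, f (x v) ∂iidLaw d p = ∫ a, f a ∂p :=
  integral_comp_measurePreserving (measurePreserving_eval_infinitePi (fun _ => p) v)
    (measurable_of_finite f).aestronglyMeasurable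

lemma variance_information_apply (v : Fin d → ℤ) :
    Var[fun x => information p (x v); iidLaw d p] = Var[information p; p] :=
  (measurePreserving_eval_infinitePi (fun _ => p) v).variance_fun_comp
    (measurable_of_finite _).aemeasurable

end Marginal

end Information

section CentredInfo

variable {d : ℕ} {A : Type*} [Fintype A] [MeasurableSpace A] (p : Measure A)

/-- The centred information `∑ v ∈ s, (I_p(x_v) - h(p))` of the pattern of `x` on `s`. -/
def centredInfo (s : Finset (Fin d → ℤ)) (x : Config d A) : ℝ :=
  ∑ v ∈ s, (information p (x v) - entropy p)

lemma dependsOn_centredInfo (s : Finset (Fin d → ℤ)) :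
    DependsOn (centredInfo p s) (s : Set (Fin d → ℤ)) :=
  fun x y hxy => Finset.sum_congr rfl fun v hv => by rw [hxy v hv]

lemma isLocal_centredInfo (s : Finset (Fin d → ℤ)) : IsLocal (centredInfo p s) :=
  ⟨s, dependsOn_centredInfo p s⟩

lemma centredInfo_sub_of_subset {s t : Finset (Fin d → ℤ)} (hst : s ⊆ t) :
    centredInfo p t - centredInfo p s = centredInfo p (t \ s) := by
  ext x
  exact sub_eq_of_eq_add (Finset.sum_sdiff hst).symm

variable [MeasurableSingletonClass A] [IsProbabilityMeasure p]

lemma iIndepFun_information_sub_entropy :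
    iIndepFun (fun (v : Fin d → ℤ) x => information p (x v) - entropy p) (iidLaw d p) :=
  iIndepFun_infinitePi (X := fun _ a => information p a - entropy p)
    fun _ => measurable_of_finite _

lemma integral_information_sub_entropy (v : Fin d → ℤ) :
    ∫ x, (information p (x v) - entropy p) ∂iidLaw d p = 0 := by
  rw [integral_comp_apply p fun a => information p a - entropy p,
    integral_sub .of_finite (integrable_const _), integral_information]
  simp

lemma integral_centredInfo (s : Finset (Fin d → ℤ)) : ∫ x, centredInfo p s x ∂iidLaw d p = 0 := by
  unfold centredInfo
  rw [integral_finsetSum _ fun v _ =>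
    (IsLocal.comp_apply (fun a => information p a - entropy p) v).integrable _]
  exact Finset.sum_eq_zero fun v _ => integral_information_sub_entropy p v

lemma variance_centredInfo (s : Finset (Fin d → ℤ)) :
    Var[centredInfo p s; iidLaw d p] = s.card * Var[information p; p] := by
  have hsum : centredInfo p s = ∑ v ∈ s, fun x => information p (x v) - entropy p := by
    ext x
    simp [centredInfo]
  have hloc : ∀ v : Fin d → ℤ, IsLocal fun x => information p (x v) :=
    IsLocal.comp_apply (information p)
  rw [hsum, IndepFun.variance_sum
    (fun v _ => ((hloc v).comp (· - entropy p)).memLp _ 2)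
    (fun v _ w _ hvw => (iIndepFun_information_sub_entropy p).indepFun hvw)]
  simp_rw [variance_sub_const (hloc _).measurable.aestronglyMeasurable,
    variance_information_apply, Finset.sum_const, nsmul_eq_mul]

lemma lpNorm_centredInfo (s : Finset (Fin d → ℤ)) :
    lpNorm (centredInfo p s) 2 (iidLaw d p) = √(s.card * Var[information p; p]) := by
  have hloc := isLocal_centredInfo p s
  rw [← variance_centredInfo, variance_of_integral_eq_zero hloc.measurable.aemeasurable
    (integral_centredInfo p s), ← lpNorm_two_sq (hloc.memLp _ 2), Real.sqrt_sq lpNorm_nonneg]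

lemma exists_hasSubgaussianMGF_centredInfo :
    ∃ c : NNReal, ∀ s : Finset (Fin d → ℤ),
      HasSubgaussianMGF (centredInfo p s) (s.card * c) (iidLaw d p) := by
  obtain ⟨K, hK⟩ := exists_information_le p
  refine ⟨(‖K - 0‖₊ / 2) ^ 2, fun s => ?_⟩
  have hsub : ∀ v : Fin d → ℤ, HasSubgaussianMGF
      (fun x => information p (x v) - entropy p) ((‖K - 0‖₊ / 2) ^ 2) (iidLaw d p) := fun v => by
    have hmeas : Measurable fun x : Config d A => information p (x v) :=
      (IsLocal.comp_apply (information p) v).measurable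
    simpa only [integral_comp_apply p (information p), integral_information] using
      hasSubgaussianMGF_of_mem_Icc (μ := iidLaw d p) hmeas.aemeasurable
        (.of_forall fun x => ⟨information_nonneg p _, hK _⟩)
  unfold centredInfo
  simpa only [Finset.sum_const, nsmul_eq_mul] using
    HasSubgaussianMGF.sum_of_iIndepFun (iIndepFun_information_sub_entropy p) (s := s)
      fun v _ => hsub v

end CentredInfo

section Truncation

variable {d : ℕ} {A : Type*} [Fintype A] [MeasurableSpace A] [MeasurableSingletonClass A]
  (p : Measure A) [IsProbabilityMeasure p]

lemma lpNorm_centredInfo_sub_clip_le {s t : Finset (Fin d → ℤ)} (hst : s ⊆ t) {c : NNReal}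
    (hc : HasSubgaussianMGF (centredInfo p s) (s.card * c) (iidLaw d p)) {r τ : ℝ} (hr : 0 < r)
    (hτ : 0 ≤ τ) (ht : t.card ≤ r ^ 2) :
    lpNorm (centredInfo p t - clip (τ * r) ∘ centredInfo p s) 2 (iidLaw d p) ≤
      √((t.card - s.card) * Var[information p; p]) +
        r * √(4 * Real.exp (c / 2) * Real.exp (-τ)) := by
  have hs := isLocal_centredInfo p s
  have hclip : IsLocal (clip (τ * r) ∘ centredInfo p s) := hs.comp _
  have hdiff : IsLocal (centredInfo p t - centredInfo p s) := (isLocal_centredInfo p t).sub hs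
  have hcard : (s.card : ℝ) ≤ t.card := mod_cast Finset.card_le_card hst
  calc lpNorm (centredInfo p t - clip (τ * r) ∘ centredInfo p s) 2 (iidLaw d p)
      = lpNorm ((centredInfo p t - centredInfo p s) +
          (centredInfo p s - clip (τ * r) ∘ centredInfo p s)) 2 (iidLaw d p) := by
        rw [sub_add_sub_cancel]
    _ ≤ lpNorm (centredInfo p t - centredInfo p s) 2 (iidLaw d p) +
          lpNorm (centredInfo p s - clip (τ * r) ∘ centredInfo p s) 2 (iidLaw d p) :=
        lpNorm_add_le (hdiff.memLp _ 2) one_le_two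
    _ ≤ _ := by
        gcongr
        · rw [centredInfo_sub_of_subset p hst, lpNorm_centredInfo,
            Finset.card_sdiff_of_subset hst, Nat.cast_sub (Finset.card_le_card hst)]
        · rw [← Real.sqrt_sq hr.le, ← Real.sqrt_mul (sq_nonneg r), Real.sqrt_sq hr.le]
          refine lpNorm_two_le_of_integral_sq_le ((hs.sub hclip).memLp _ 2) ?_
          refine integral_sub_clip_sq_le_of_hasSubgaussianMGF hc hr hτ ?_
          push_cast
          rw [mul_comm]
          gcongr
          exact hcard.trans ht

lemma tendsto_sqrt_one_sub_pow_add_sqrt_exp_neg (d : ℕ) (a b c : ℝ) :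
    Tendsto (fun k : ℕ => √((1 - (1 - a / k) ^ d) * b) + √(c * Real.exp (-k))) atTop (𝓝 0) := by
  have hratio : Tendsto (fun k : ℕ => (1 - (1 - a / k) ^ d) * b) atTop (𝓝 0) := by
    simpa using ((((tendsto_const_div_atTop_nhds_zero_nat a).const_sub 1).pow d).const_sub
      1).mul_const b
  have hexp : Tendsto (fun k : ℕ => c * Real.exp (-k)) atTop (𝓝 0) := by
    simpa using (Real.tendsto_exp_neg_atTop_nhds_zero.comp tendsto_natCast_atTop_atTop).const_mul c
  simpa using hratio.sqrt.add hexp.sqrt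

lemma eventually_lpNorm_centredInfo_sub_clip_le {ε : ℝ} (hε : 0 < ε) :
    ∀ᶠ k : ℕ in atTop, ∀ m : ℕ, 0 < m → ∀ n : ℕ, n = k * m →
      lpNorm (centredInfo p (box d 0 n) -
        clip (k * √((n : ℝ) ^ d)) ∘ centredInfo p (box d (2 * m) (n - 2 * m))) 2 (iidLaw d p) ≤
          ε * √((n : ℝ) ^ d) := by
  obtain ⟨c, hc⟩ := exists_hasSubgaussianMGF_centredInfo (d := d) p
  filter_upwards [(tendsto_sqrt_one_sub_pow_add_sqrt_exp_neg d 4 Var[information p; p]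
    (4 * Real.exp (c / 2))).eventually_le_const hε, eventually_ge_atTop 4] with k hk hk4
  rintro m hm n rfl
  set n := k * m with hn
  have hk0 : (0 : ℝ) < k := by positivity
  have : (0 : ℝ) < n := by positivity
  have hmn : 4 * (m : ℤ) ≤ n := by rw [hn]; push_cast; gcongr; exact_mod_cast hk4
  have hcell : ((box d 0 n).card : ℝ) = √((n : ℝ) ^ d) ^ 2 := by
    rw [Real.sq_sqrt (by positivity), card_box (by positivity)]
    simp
  have hinner : ((box d (2 * m) (n - 2 * m)).card : ℝ) =
      √((n : ℝ) ^ d) ^ 2 * (1 - 4 / k) ^ d := by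
    rw [Real.sq_sqrt (by positivity), card_box (by linarith), ← mul_pow, hn]
    push_cast
    congr 1
    field_simp
    ring
  refine (lpNorm_centredInfo_sub_clip_le p (box_subset_box (by positivity) (by linarith)) (hc _)
    (by positivity) hk0.le hcell.le).trans ?_
  rw [hcell, hinner, ← mul_one_sub, mul_assoc, Real.sqrt_mul (sq_nonneg _),
    Real.sqrt_sq (Real.sqrt_nonneg _), ← mul_add, mul_comm ε]
  gcongr

end Truncation

section CodingRadius

variable {d : ℕ} {A B : Type*} [MeasurableSpace A] {μ : Measure (Config d A)}
  {φ : Config d A → Config d B} {x : Config d A} {m n : ℕ}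

lemma Determines.mono (hmn : m ≤ n) (h : Determines μ φ x m) : Determines μ φ x n := by
  unfold Determines at h ⊢
  filter_upwards [h] with a ha hax
  exact ha fun i hi => hax i fun k => (hi k).trans (mod_cast hmn)

lemma codingRadius_le_iff : codingRadius μ φ x ≤ m ↔ Determines μ φ x m := by
  refine ⟨fun h => ?_, fun h => iInf₂_le m h⟩
  by_contra hm
  refine (ENat.add_one_le_iff (ENat.natCast_ne_top m)).1 (le_iInf₂ fun n hn => ?_) |>.not_ge h
  have hmn : m < n := not_le.1 fun hnm => hm (hn.mono hnm)
  exact_mod_cast hmn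

lemma measurableSet_determines [Finite A] [MeasurableSingletonClass A] [Finite B]
    [MeasurableSpace B] [MeasurableSingletonClass B] (hφ : Measurable φ) (m : ℕ) :
    MeasurableSet {x | Determines μ φ x m} := by
  let π : Config d A → (box d (-m) (m + 1) → A) × B := fun x => (Finset.restrict _ x, φ x 0)
  have hπ : Measurable π :=
    (Finset.measurable_restrict _).prodMk ((measurable_pi_apply 0).comp hφ)
  have hsat : {x | Determines μ φ x m} = π ⁻¹' (π '' {x | Determines μ φ x m}) := by
    refine (Set.subset_preimage_image _ _).antisymm ?_
    rintro x ⟨y, hy, hyx⟩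
    have hcube : ∀ i ∈ cube d m, y i = x i := fun i hi =>
      congrFun (congrArg Prod.fst hyx) ⟨i, by rwa [← Finset.mem_coe, coe_box_eq_cube]⟩
    have hzero : φ y 0 = φ x 0 := congrArg Prod.snd hyx
    refine Filter.Eventually.mono (show ∀ᵐ a ∂μ, _ from hy) fun a ha hax => ?_
    exact hzero ▸ ha fun i hi => (hax i hi).trans (hcube i hi).symm
  rw [hsat]
  exact hπ (Set.toFinite _).measurableSet

variable (μ φ) in
/-- The probability that the coding radius exceeds `m`; it bounds the error of replacing `φ` by
what the patterns of radius `m` force. -/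
def codingTail (m : ℕ) : ℝ≥0∞ := μ {x | m < codingRadius μ φ x}

lemma setOf_lt_codingRadius : {x | m < codingRadius μ φ x} = {x | Determines μ φ x m}ᶜ :=
  Set.ext fun _ => not_le.symm.trans codingRadius_le_iff.not

lemma tendsto_rpow_mul_measure_lt {Ω : Type*} [MeasurableSpace Ω] {μ : Measure Ω}
    [IsFiniteMeasure μ] {R : Ω → ℕ∞} (hR : ∀ m : ℕ, MeasurableSet {ω | m < R ω})
    (hfin : ∀ᵐ ω ∂μ, R ω < ⊤) {α : ℝ} (hα : 0 ≤ α) (hmom : ∫⁻ ω, (R ω : ℝ≥0∞) ^ α ∂μ ≠ ⊤) :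
    Tendsto (fun m : ℕ => (m : ℝ≥0∞) ^ α * μ {ω | m < R ω}) atTop (𝓝 0) := by
  have hzero : μ (⋂ m : ℕ, {ω | m < R ω}) = 0 := by
    refine measure_mono_null (fun ω hω => ?_) (ae_iff.1 hfin)
    exact (ENat.eq_top_iff_forall_gt.2 fun m => Set.mem_iInter.1 hω m).not_lt
  have hlim : Tendsto (fun m : ℕ => μ {ω | m < R ω}) atTop (𝓝 0) := hzero ▸
    tendsto_measure_iInter_atTop (fun m => (hR m).nullMeasurableSet)
      (fun m n hmn ω hω => show (m : ℕ∞) < R ω from lt_of_le_of_lt (mod_cast hmn) hω)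
      ⟨0, measure_ne_top _ _⟩
  refine tendsto_of_tendsto_of_tendsto_of_le_of_le tendsto_const_nhds
    (tendsto_setLIntegral_zero hmom hlim) (fun _ => zero_le) fun m => ?_
  rw [← setLIntegral_const]
  refine setLIntegral_mono' (hR m) fun ω hω => ENNReal.rpow_le_rpow ?_ hα
  rw [← ENat.toENNReal_coe]
  exact ENat.toENNReal_le.2 (le_of_lt hω)

lemma tendsto_rpow_mul_codingTail [Finite A] [MeasurableSingletonClass A] [Finite B]
    [MeasurableSpace B] [MeasurableSingletonClass B] [IsFiniteMeasure μ] (hφ : Measurable φ)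
    (hfin : IsFinitary μ φ) {α : ℝ} (hα : 0 ≤ α) (hmom : codingMoment μ φ α ≠ ⊤) :
    Tendsto (fun m : ℕ => (m : ℝ≥0∞) ^ α * codingTail μ φ m) atTop (𝓝 0) :=
  tendsto_rpow_mul_measure_lt
    (fun m => by
      rw [setOf_lt_codingRadius]
      exact (measurableSet_determines hφ m).compl) hfin hα hmom

end CodingRadius

section LocalCode

variable {d : ℕ} {A B : Type*} [MeasurableSpace A] [MeasurableSpace B]
  {μ : Measure (Config d A)} {φ : Config d A → Config d B} {m : ℕ} {x : Config d A}

/-- The pattern of `x` on `cube d m` forces the symbol `b` at the origin of the image. -/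
def Forces (μ : Measure (Config d A)) (φ : Config d A → Config d B) (m : ℕ) (x : Config d A)
    (b : B) : Prop :=
  ∀ᵐ a ∂μ, (∀ i ∈ cube d m, a i = x i) → φ a 0 = b

open scoped Classical in
/-- The information of the symbol at the origin forced by the pattern of `x` on `cube d m`: an
approximation of `information q (φ x 0)` that depends on finitely many coordinates. It is set to
`0`, the least possible information, if no symbol is forced. -/
def localInfo (μ : Measure (Config d A)) (φ : Config d A → Config d B) (q : Measure B) (m : ℕ)
    (x : Config d A) : ℝ :=
  if h : ∃ b, Forces μ φ m x b then information q h.choose else 0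

omit [MeasurableSpace B] in
lemma forces_congr {y : Config d A} (h : ∀ i ∈ cube d m, x i = y i) :
    Forces μ φ m x = Forces μ φ m y := by
  funext b
  refine propext (eventually_congr (.of_forall fun a => ?_))
  rw [forall₂_congr fun i hi => by rw [h i hi]]

variable (μ φ m) in
lemma dependsOn_localInfo (q : Measure B) :
    DependsOn (localInfo μ φ q m) (box d (-m) (m + 1) : Set (Fin d → ℤ)) := by
  intro x y hxy
  rw [coe_box_eq_cube] at hxy
  unfold localInfo
  rw [forces_congr hxy]

variable (μ φ m x) in
lemma localInfo_nonneg (q : Measure B) [IsProbabilityMeasure q] : 0 ≤ localInfo μ φ q m x := by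
  unfold localInfo
  split_ifs
  exacts [information_nonneg q _, le_rfl]

variable (μ φ m x) in
lemma localInfo_le (q : Measure B) {K : ℝ} (hK0 : 0 ≤ K) (hK : ∀ b, information q b ≤ K) :
    localInfo μ φ q m x ≤ K := by
  unfold localInfo
  split_ifs
  exacts [hK _, hK0]

variable [MeasurableSingletonClass A]

lemma measureReal_cylinder (p : Measure A) [IsProbabilityMeasure p] (s : Finset (Fin d → ℤ))
    (x : Config d A) :
    (iidLaw d p).real ((s : Set (Fin d → ℤ)).pi fun i => {x i}) = ∏ i ∈ s, p.real {x i} := by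
  rw [measureReal_def, iidLaw, Measure.infinitePi_pi _ fun i _ => measurableSet_singleton _,
    ENNReal.toReal_prod]
  rfl

section Information

variable [MeasurableSingletonClass B] {p : Measure A} [IsProbabilityMeasure p]
  {q : Measure B} [IsProbabilityMeasure q]
  (hφ : IsFactorMap (iidLaw d p) (iidLaw d q) φ) {s t : Finset (Fin d → ℤ)}
  (hst : ∀ v ∈ s, ∀ i ∈ cube d m, i + v ∈ t)
include hφ hst

lemma prod_measureReal_le_of_forces {y : Config d B}
    (hy : ∀ v ∈ s, Forces (iidLaw d p) φ m (shift v x) (y v)) :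
    ∏ i ∈ t, p.real {x i} ≤ ∏ v ∈ s, q.real {y v} := by
  have hcyl : MeasurableSet ((s : Set (Fin d → ℤ)).pi fun v => {y v}) :=
    .pi s.countable_toSet fun _ _ => measurableSet_singleton _
  rw [← measureReal_cylinder p t x, ← measureReal_cylinder q s y,
    ← hφ.measurePreserving.measureReal_preimage hcyl.nullMeasurableSet]
  refine ENNReal.toReal_mono (measure_ne_top _ _) (measure_mono_ae ?_)
  have hequiv : ∀ᵐ a ∂iidLaw d p, ∀ v ∈ s, φ (shift v a) = shift v (φ a) :=
    (Finset.eventually_all s).2 fun v _ => hφ.equivariant v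
  have hforced : ∀ᵐ a ∂iidLaw d p, ∀ v ∈ s,
      (∀ i ∈ cube d m, shift v a i = shift v x i) → φ (shift v a) 0 = y v :=
    (Finset.eventually_all s).2 fun v hv =>
      (measurePreserving_shift p v).quasiMeasurePreserving.ae (hy v hv)
  filter_upwards [hequiv, hforced] with a hequiv hforced ha v hv
  have h := hforced v hv fun i hi => ha _ (hst v hv i hi)
  rw [hequiv v hv] at h
  simpa [shift] using h

variable (hx : ∀ i, p.real {x i} ≠ 0)
include hx

lemma sum_information_le_of_forces {y : Config d B}
    (hy : ∀ v ∈ s, Forces (iidLaw d p) φ m (shift v x) (y v)) :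
    ∑ v ∈ s, information q (y v) ≤ ∑ i ∈ t, information p (x i) := by
  have hle := prod_measureReal_le_of_forces hφ hst hy
  have hpos : 0 < ∏ i ∈ t, p.real {x i} :=
    Finset.prod_pos fun i _ => measureReal_nonneg.lt_of_ne' (hx i)
  have hq : ∀ v ∈ s, q.real {y v} ≠ 0 := Finset.prod_ne_zero_iff.1 (hpos.trans_le hle).ne'
  have hlog := Real.log_le_log hpos hle
  rw [Real.log_prod fun i _ => hx i, Real.log_prod hq] at hlog
  simp only [information, Real.log_inv, Finset.sum_neg_distrib]
  exact neg_le_neg hlog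

open scoped Classical in
lemma sum_localInfo_le :
    ∑ v ∈ s, localInfo (iidLaw d p) φ q m (shift v x) ≤ ∑ i ∈ t, information p (x i) := by
  let s' := s.filter fun v => ∃ b, Forces (iidLaw d p) φ m (shift v x) b
  let y : Config d B := fun v =>
    if h : ∃ b, Forces (iidLaw d p) φ m (shift v x) b then h.choose else φ x v
  have hy : ∀ v ∈ s', Forces (iidLaw d p) φ m (shift v x) (y v) := fun v hv => by
    have h := (Finset.mem_filter.1 hv).2
    simpa only [y, dif_pos h] using h.choose_spec
  calc ∑ v ∈ s, localInfo (iidLaw d p) φ q m (shift v x)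
      = ∑ v ∈ s', information q (y v) := by
        rw [Finset.sum_filter]
        refine Finset.sum_congr rfl fun v _ => ?_
        by_cases h : ∃ b, Forces (iidLaw d p) φ m (shift v x) b
        · simp only [localInfo, y, dif_pos h, if_pos h]
        · simp only [localInfo, dif_neg h, if_neg h]
    _ ≤ ∑ i ∈ t, information p (x i) :=
        sum_information_le_of_forces hφ (fun v hv => hst v (Finset.mem_filter.1 hv).1) hx hy

end Information

lemma localInfo_eq_of_determines {p : Measure A} [IsProbabilityMeasure p] (q : Measure B)
    (hx : ∀ i, p.real {x i} ≠ 0) (hdet : Determines (iidLaw d p) φ x m) :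
    localInfo (iidLaw d p) φ q m x = information q (φ x 0) := by
  have h : ∃ b, Forces (iidLaw d p) φ m x b := ⟨_, hdet⟩
  have hpos : 0 < (iidLaw d p).real ((cube d m).pi fun i => {x i}) := by
    rw [← coe_box_eq_cube, measureReal_cylinder]
    exact Finset.prod_pos fun i _ => measureReal_nonneg.lt_of_ne' (hx i)
  have heq : h.choose = φ x 0 := by
    by_contra hne
    refine hpos.ne' ((measureReal_eq_zero_iff).2 (measure_eq_zero_iff_ae_notMem.2 ?_))
    filter_upwards [h.choose_spec, hdet] with a hchoose hdet ha
    exact hne ((hchoose ha).symm.trans (hdet ha))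
  rw [localInfo, dif_pos h, heq]

lemma ae_abs_localInfo_sub_le [Countable A] (p : Measure A) [IsProbabilityMeasure p]
    (q : Measure B) [IsProbabilityMeasure q] (φ : Config d A → Config d B) (m : ℕ) {K : ℝ}
    (hK : ∀ b, information q b ≤ K) :
    ∀ᵐ x ∂iidLaw d p, |localInfo (iidLaw d p) φ q m x - information q (φ x 0)| ≤
      {x | m < codingRadius (iidLaw d p) φ x}.indicator (fun _ => K) x := by
  filter_upwards [ae_measureReal_singleton_ne_zero p] with x hx
  have hI : 0 ≤ information q (φ x 0) := information_nonneg q _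
  rw [setOf_lt_codingRadius]
  by_cases hdet : Determines (iidLaw d p) φ x m
  · rw [localInfo_eq_of_determines q hx hdet, sub_self, abs_zero]
    exact Set.indicator_nonneg (fun _ _ => hI.trans (hK _)) x
  · rw [Set.indicator_of_mem (show x ∈ _ from hdet), abs_sub_le_iff]
    have hL : 0 ≤ localInfo (iidLaw d p) φ q m x := localInfo_nonneg ..
    have hL' : localInfo (iidLaw d p) φ q m x ≤ K := localInfo_le _ _ _ _ q (hI.trans (hK _)) hK
    exact ⟨by linarith, by linarith [hK (φ x 0)]⟩

section Error

variable [Finite A] [Finite B] [MeasurableSingletonClass B] {p : Measure A}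
  [IsProbabilityMeasure p] {q : Measure B} [IsProbabilityMeasure q]
  (hφ : IsFactorMap (iidLaw d p) (iidLaw d q) φ)
include hφ

lemma integrable_localInfo_sub (m : ℕ) :
    Integrable (fun x => localInfo (iidLaw d p) φ q m x - information q (φ x 0)) (iidLaw d p) :=
  .sub (IsLocal.integrable _ ⟨_, dependsOn_localInfo _ φ m q⟩) <|
    hφ.measurePreserving.integrable_comp_of_integrable <|
      (IsLocal.comp_apply (information q) 0).integrable _

lemma integral_abs_localInfo_sub_le {K : ℝ} (hK : ∀ b, information q b ≤ K) (m : ℕ) :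
    ∫ x, |localInfo (iidLaw d p) φ q m x - information q (φ x 0)| ∂iidLaw d p ≤
      K * (codingTail (iidLaw d p) φ m).toReal := by
  have hset : MeasurableSet {x | m < codingRadius (iidLaw d p) φ x} := by
    rw [setOf_lt_codingRadius]
    exact (measurableSet_determines hφ.measurePreserving.measurable m).compl
  refine (integral_mono_ae (integrable_localInfo_sub hφ m).abs
    ((integrable_const K).indicator hset) (ae_abs_localInfo_sub_le p q φ m hK)).trans_eq ?_
  rw [integral_indicator_const K hset, smul_eq_mul, mul_comm]
  rfl

end Error

end LocalCode

section CentredLocalInfo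

variable {d : ℕ} {A B : Type*} [MeasurableSpace A] [Fintype B] [MeasurableSpace B]

/-- The analogue of `centredInfo q s (φ x)` for the local approximation `localInfo` of the
information of the image. -/
def centredLocalInfo (μ : Measure (Config d A)) (φ : Config d A → Config d B) (q : Measure B)
    (m : ℕ) (s : Finset (Fin d → ℤ)) (x : Config d A) : ℝ :=
  ∑ v ∈ s, (localInfo μ φ q m (shift v x) - entropy q)

lemma sum_centredLocalInfo_shift (μ : Measure (Config d A)) (φ : Config d A → Config d B)
    (q : Measure B) (m M n : ℕ) (x : Config d A) :
    ∑ j ∈ box d 0 M, centredLocalInfo μ φ q m (box d 0 n) (shift ((n : ℤ) • j) x) =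
      centredLocalInfo μ φ q m (box d 0 (M * n)) x := by
  simp only [centredLocalInfo, shift_shift]
  exact sum_box_tiling fun v => localInfo μ φ q m (shift v x) - entropy q

lemma sum_centredInfo_shift [Fintype A] (p : Measure A) (M n : ℕ) (x : Config d A) :
    ∑ j ∈ box d 0 M, centredInfo p (box d 0 n) (shift ((n : ℤ) • j) x) =
      centredInfo p (box d 0 (M * n)) x :=
  sum_box_tiling fun v => information p (x v) - entropy p

lemma dependsOn_centredLocalInfo (μ : Measure (Config d A)) (φ : Config d A → Config d B)
    (q : Measure B) {m : ℕ} {s t : Finset (Fin d → ℤ)} (hst : ∀ v ∈ s, ∀ i ∈ cube d m, i + v ∈ t) :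
    DependsOn (centredLocalInfo μ φ q m s) (t : Set (Fin d → ℤ)) := fun _ _ hxy =>
  Finset.sum_congr rfl fun v hv => congrArg (· - entropy q) <|
    dependsOn_localInfo μ φ m q fun i hi => hxy (i + v) (hst v hv i (coe_box_eq_cube d m ▸ hi))

lemma isLocal_centredLocalInfo (μ : Measure (Config d A)) (φ : Config d A → Config d B)
    (q : Measure B) (m : ℕ) (s : Finset (Fin d → ℤ)) : IsLocal (centredLocalInfo μ φ q m s) :=
  .sum fun v _ => (IsLocal.comp_shift ⟨_, dependsOn_localInfo μ φ m q⟩ v).comp (· - entropy q)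

variable [MeasurableSingletonClass A] [MeasurableSingletonClass B]
  {p : Measure A} [IsProbabilityMeasure p] {q : Measure B} [IsProbabilityMeasure q]
  {φ : Config d A → Config d B} (hφ : IsFactorMap (iidLaw d p) (iidLaw d q) φ)
include hφ

lemma neg_mul_card_sdiff_le_centredInfo_sub_centredLocalInfo [Fintype A]
    (hent : entropy p = entropy q) {K : ℝ} (hK : ∀ a, information p a ≤ K) {m : ℕ}
    {s t : Finset (Fin d → ℤ)} (hst : ∀ v ∈ s, ∀ i ∈ cube d m, i + v ∈ t) {x : Config d A}
    (hx : ∀ i, p.real {x i} ≠ 0) :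
    -(K * (t.card - s.card)) ≤
      centredInfo p s x - centredLocalInfo (iidLaw d p) φ q m s x := by
  have hs : s ⊆ t := fun v hv => by simpa using hst v hv 0 (by simp [cube])
  have hforced : ∑ v ∈ s, localInfo (iidLaw d p) φ q m (shift v x) ≤ ∑ i ∈ t, information p (x i) :=
    sum_localInfo_le hφ hst hx
  have hboundary : ∑ i ∈ t \ s, information p (x i) ≤ K * (t.card - s.card) := by
    refine (Finset.sum_le_card_nsmul _ _ K fun i _ => hK (x i)).trans_eq ?_
    rw [Finset.card_sdiff_of_subset hs, nsmul_eq_mul, Nat.cast_sub (Finset.card_le_card hs),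
      mul_comm]
  rw [← Finset.sum_sdiff hs] at hforced
  simp only [centredInfo, centredLocalInfo, Finset.sum_sub_distrib, hent]
  linarith

lemma integral_abs_centredInfo_sub_centredLocalInfo_le [Finite A] {K : ℝ}
    (hK : ∀ b, information q b ≤ K) (m : ℕ) (s : Finset (Fin d → ℤ)) :
    ∫ x, |centredInfo q s (φ x) - centredLocalInfo (iidLaw d p) φ q m s x| ∂iidLaw d p ≤
      s.card * (K * (codingTail (iidLaw d p) φ m).toReal) := by
  set μ := iidLaw d p
  let error : Config d A → ℝ := fun x => |localInfo μ φ q m x - information q (φ x 0)|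
  have hint : Integrable error μ := (integrable_localInfo_sub hφ m).abs
  have hshift : ∀ v : Fin d → ℤ, Integrable (fun x => error (shift v x)) μ := fun v =>
    (measurePreserving_shift p v).integrable_comp_of_integrable hint
  have hequiv : ∀ᵐ x ∂μ, ∀ v : Fin d → ℤ, φ (shift v x) = shift v (φ x) :=
    ae_all_iff.2 hφ.equivariant
  calc ∫ x, |centredInfo q s (φ x) - centredLocalInfo μ φ q m s x| ∂μ
      ≤ ∫ x, ∑ v ∈ s, error (shift v x) ∂μ := by
        refine integral_mono_of_nonneg (.of_forall fun _ => abs_nonneg _)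
          (integrable_finsetSum _ fun v _ => hshift v) (hequiv.mono fun x hx => ?_)
        simp only [centredInfo, centredLocalInfo, ← Finset.sum_sub_distrib]
        refine (Finset.abs_sum_le_sum_abs _ _).trans_eq (Finset.sum_congr rfl fun v _ => ?_)
        simp only [error, hx v, shift, zero_add, sub_sub_sub_cancel_right, abs_sub_comm]
    _ = s.card * ∫ x, error x ∂μ := by
        rw [integral_finsetSum _ fun v _ => hshift v, ← nsmul_eq_mul, ← Finset.sum_const]
        exact Finset.sum_congr rfl fun v _ => integral_comp_measurePreserving
          (measurePreserving_shift p v) hint.aestronglyMeasurable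
    _ ≤ s.card * (K * (codingTail μ φ m).toReal) := by
        gcongr
        exact integral_abs_localInfo_sub_le hφ hK m

end CentredLocalInfo

section Correlation

variable {d : ℕ} {A B : Type*} [Fintype A] [MeasurableSpace A] [MeasurableSingletonClass A]
  [Fintype B] [MeasurableSpace B] [MeasurableSingletonClass B]
  {p : Measure A} [IsProbabilityMeasure p] {q : Measure B} [IsProbabilityMeasure q]

lemma tendsto_card_box_sub_card_box_div (d m n : ℕ) :
    Tendsto (fun M : ℕ => (((box d (-m) (M * n + m)).card : ℝ) - (box d 0 (M * n)).card) /
      (M : ℝ) ^ d) atTop (𝓝 0) := by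
  have hlim : Tendsto (fun M : ℕ => ((n : ℝ) + 2 * m / M) ^ d - (n : ℝ) ^ d) atTop (𝓝 0) := by
    simpa using (((tendsto_const_div_atTop_nhds_zero_nat (2 * m : ℝ)).const_add (n : ℝ)).pow
      d).sub_const ((n : ℝ) ^ d)
  refine hlim.congr' ((eventually_gt_atTop 0).mono fun M hM => ?_)
  have hMn : (0 : ℤ) ≤ M * n := by positivity
  beta_reduce
  rw [card_box (by linarith), card_box hMn, sub_div, ← div_pow, ← div_pow]
  push_cast
  congr 2 <;> field_simp <;> ring

lemma disjoint_map_box {m n : ℕ} {j k : Fin d → ℤ} (hjk : j ≠ k) :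
    Disjoint ((box d (-m) (n + m)).map (addRightEmbedding ((n : ℤ) • j)))
      ((box d m (n - m)).map (addRightEmbedding ((n : ℤ) • k))) := by
  obtain ⟨l, hl⟩ := Function.ne_iff.1 hjk
  refine Finset.disjoint_left.2 fun v hv hv' => ?_
  obtain ⟨a, ha, rfl⟩ := Finset.mem_map.1 hv
  obtain ⟨b, hb, hab⟩ := Finset.mem_map.1 hv'
  have hcoord : b l + n * k l = a l + n * j l := congrFun hab l
  have ha := mem_box.1 ha l
  have hb := mem_box.1 hb l
  rcases hl.lt_or_gt with h | h <;> nlinarith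

variable {φ : Config d A → Config d B} (hφ : IsFactorMap (iidLaw d p) (iidLaw d q) φ)
  (hent : entropy p = entropy q) {m n : ℕ}
include hφ hent

lemma integral_centredInfo_sub_centredLocalInfo_mul_nonneg {W : Config d A → ℝ}
    (hW : DependsOn W (box d m (n - m) : Set (Fin d → ℤ))) (hW0 : ∀ x, 0 ≤ W x) :
    0 ≤ ∫ x, (centredInfo p (box d 0 n) x - centredLocalInfo (iidLaw d p) φ q m (box d 0 n) x) *
      W x ∂iidLaw d p := by
  obtain ⟨K, hK⟩ := exists_information_le p
  have hdep : DependsOn (fun x => centredInfo p (box d 0 n) x -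
      centredLocalInfo (iidLaw d p) φ q m (box d 0 n) x)
      (box d (-m) (n + m) : Set (Fin d → ℤ)) := fun x y hxy =>
    congrArg₂ _ (dependsOn_centredInfo p _ fun v hv =>
        hxy v (box_subset_box (by simp) (by simp) hv))
      (dependsOn_centredLocalInfo _ φ q (fun v hv i hi => by
        simpa using add_mem_box_of_mem_cube hi hv) hxy)
  refine integral_mul_nonneg_of_ae_le_sum_shift p (n := n)
    (c := fun M => -(K * ((box d (-m) (M * n + m)).card - (box d 0 (M * n)).card)))
    hdep hW (box_subset_box (by linarith) (by linarith)) hW0 (fun j k => disjoint_map_box)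
    (fun M => ?_) ?_
  · filter_upwards [ae_measureReal_singleton_ne_zero p] with x hx
    rw [Finset.sum_sub_distrib, sum_centredInfo_shift, sum_centredLocalInfo_shift]
    exact neg_mul_card_sdiff_le_centredInfo_sub_centredLocalInfo hφ hent hK
      (fun v hv i hi => by simpa using add_mem_box_of_mem_cube hi hv) hx
  · simpa [neg_div, mul_div_assoc] using
      ((tendsto_card_box_sub_card_box_div d m n).const_mul K).neg

variable {ψ : Config d A → ℝ} (hψ : DependsOn ψ (box d m (n - m) : Set (Fin d → ℤ)))
  {b : ℝ} (hb : ∀ x, |ψ x| ≤ b) {K : ℝ} (hK : ∀ y, information q y ≤ K)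
include hψ hb

lemma abs_integral_mul_centredInfo_sub_centredLocalInfo_le :
    |∫ x, ψ x * (centredInfo p (box d 0 n) x -
      centredLocalInfo (iidLaw d p) φ q m (box d 0 n) x) ∂iidLaw d p| ≤
      b * ∫ x, (centredInfo p (box d 0 n) x -
        centredLocalInfo (iidLaw d p) φ q m (box d 0 n) x) ∂iidLaw d p := by
  set D : Config d A → ℝ := fun x => centredInfo p (box d 0 n) x -
    centredLocalInfo (iidLaw d p) φ q m (box d 0 n) x
  have hDloc : IsLocal D := (isLocal_centredInfo p _).sub (isLocal_centredLocalInfo _ φ q m _)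
  have hψD : Integrable (fun x => ψ x * D x) (iidLaw d p) :=
    (IsLocal.mul ⟨_, hψ⟩ hDloc).integrable _
  have hbD : Integrable (fun x => b * D x) (iidLaw d p) := (hDloc.integrable _).const_mul b
  have hadd := integral_centredInfo_sub_centredLocalInfo_mul_nonneg hφ hent
    (W := fun x => b + ψ x) (fun x y hxy => congrArg _ (hψ hxy))
    fun x => by linarith [(abs_le.1 (hb x)).1]
  have hsub := integral_centredInfo_sub_centredLocalInfo_mul_nonneg hφ hent
    (W := fun x => b - ψ x) (fun x y hxy => congrArg _ (hψ hxy))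
    fun x => by linarith [(abs_le.1 (hb x)).2]
  simp_rw [mul_comm _ (b + ψ _), add_mul] at hadd
  simp_rw [mul_comm _ (b - ψ _), sub_mul] at hsub
  rw [integral_add hbD hψD, integral_const_mul] at hadd
  rw [integral_sub hbD hψD, integral_const_mul] at hsub
  exact abs_le.2 ⟨by linarith, by linarith⟩

include hK

lemma abs_integral_mul_centredInfo_sub_centredInfo_le :
    |∫ x, ψ x * (centredInfo p (box d 0 n) x - centredInfo q (box d 0 n) (φ x)) ∂iidLaw d p| ≤
      2 * b * ((box d 0 n).card * (K * (codingTail (iidLaw d p) φ m).toReal)) := by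
  set μ := iidLaw d p
  set S : Config d A → ℝ := centredInfo p (box d 0 n)
  set T : Config d A → ℝ := fun x => centredInfo q (box d 0 n) (φ x)
  set Q : Config d A → ℝ := centredLocalInfo μ φ q m (box d 0 n)
  have hS : IsLocal S := isLocal_centredInfo p _
  have hQ : IsLocal Q := isLocal_centredLocalInfo μ φ q m _
  have hT : Integrable T μ := hφ.measurePreserving.integrable_comp_of_integrable
    ((isLocal_centredInfo q _).integrable _)
  have hψloc : IsLocal ψ := ⟨_, hψ⟩
  obtain ⟨x₀⟩ : Nonempty (Config d A) := nonempty_of_isProbabilityMeasure μ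
  have hb0 : 0 ≤ b := (abs_nonneg _).trans (hb x₀)
  have hSQ : Integrable (fun x => ψ x * (S x - Q x)) μ := (hψloc.mul (hS.sub hQ)).integrable μ
  have hTQ : Integrable (fun x => T x - Q x) μ := hT.sub (hQ.integrable μ)
  have hψTQ : Integrable (fun x => ψ x * (T x - Q x)) μ :=
    hTQ.bdd_mul hψloc.measurable.aestronglyMeasurable (.of_forall hb)
  have hmean : ∫ x, (S x - Q x) ∂μ ≤ ∫ x, |T x - Q x| ∂μ := by
    rw [integral_sub (hS.integrable μ) (hQ.integrable μ), integral_centredInfo,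
      ← integral_centredInfo q (box d 0 n), ← integral_comp_measurePreserving
        hφ.measurePreserving (isLocal_centredInfo q _).measurable.aestronglyMeasurable,
      ← integral_sub hT (hQ.integrable μ)]
    exact integral_mono hTQ hTQ.abs fun x => le_abs_self _
  calc |∫ x, ψ x * (S x - T x) ∂μ|
      = |∫ x, ψ x * (S x - Q x) ∂μ - ∫ x, ψ x * (T x - Q x) ∂μ| := by
        rw [← integral_sub hSQ hψTQ]
        simp only [← mul_sub, sub_sub_sub_cancel_right]
    _ ≤ |∫ x, ψ x * (S x - Q x) ∂μ| + |∫ x, ψ x * (T x - Q x) ∂μ| := abs_sub _ _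
    _ ≤ b * ∫ x, |T x - Q x| ∂μ + b * ∫ x, |T x - Q x| ∂μ := by
        gcongr
        · refine (abs_integral_mul_centredInfo_sub_centredLocalInfo_le hφ hent hψ hb).trans ?_
          gcongr
        · exact abs_integral_mul_le_mul_integral_abs hb hTQ
    _ ≤ 2 * b * ((box d 0 n).card * (K * (codingTail μ φ m).toReal)) := by
        rw [← two_mul, ← mul_assoc]
        gcongr
        exact integral_abs_centredInfo_sub_centredLocalInfo_le hφ hK m _

end Correlation

section FixedScale

variable {d : ℕ} {A B : Type*} [MeasurableSpace A] [MeasurableSingletonClass A]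
  [Fintype B] [MeasurableSpace B] [MeasurableSingletonClass B]
  {p : Measure A} [IsProbabilityMeasure p] {q : Measure B} [IsProbabilityMeasure q]
  {φ : Config d A → Config d B} (hφ : IsFactorMap (iidLaw d p) (iidLaw d q) φ)
  {K : ℝ} (hK : ∀ b, information q b ≤ K) {m : ℕ}
include hφ hK

lemma lpNorm_clip_centredInfo_sub_clip_centredLocalInfo_le [Finite A] {τ r : ℝ} (hτ : 0 ≤ τ)
    (hr : 0 ≤ r) {s : Finset (Fin d → ℤ)} (hs : s.card ≤ r ^ 2) :
    lpNorm (clip (τ * r) ∘ centredInfo q s ∘ φ -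
      clip (τ * r) ∘ centredLocalInfo (iidLaw d p) φ q m s) 2 (iidLaw d p) ≤
      r * √(2 * τ * K * (r * (codingTail (iidLaw d p) φ m).toReal)) := by
  set tail := (codingTail (iidLaw d p) φ m).toReal
  obtain ⟨y₀⟩ : Nonempty B := nonempty_of_isProbabilityMeasure q
  have hK0 : 0 ≤ K := (information_nonneg q y₀).trans (hK y₀)
  have hT : IsLocal (centredInfo q s) := isLocal_centredInfo q s
  have hQ : IsLocal (centredLocalInfo (iidLaw d p) φ q m s) := isLocal_centredLocalInfo _ φ q m s
  have hTφ : Integrable (centredInfo q s ∘ φ) (iidLaw d p) :=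
    hφ.measurePreserving.integrable_comp_of_integrable (hT.integrable _)
  rw [← Real.sqrt_sq hr, ← Real.sqrt_mul (sq_nonneg r), Real.sqrt_sq hr]
  refine lpNorm_two_le_of_integral_sq_le
    ((((hT.comp (clip (τ * r))).memLp _ 2).comp_measurePreserving hφ.measurePreserving).sub
      ((hQ.comp (clip (τ * r))).memLp _ 2)) ?_
  calc _ ≤ ∫ x, 2 * (τ * r) * |centredInfo q s (φ x) -
        centredLocalInfo (iidLaw d p) φ q m s x| ∂iidLaw d p :=
        integral_mono_of_nonneg (.of_forall fun _ => sq_nonneg _)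
          ((hTφ.sub (hQ.integrable _)).abs.const_mul _)
          (.of_forall fun _ => clip_sub_clip_sq_le (mul_nonneg hτ hr) _ _)
    _ ≤ 2 * (τ * r) * (s.card * (K * tail)) := by
        rw [integral_const_mul]
        gcongr
        exact integral_abs_centredInfo_sub_centredLocalInfo_le hφ hK m s
    _ ≤ 2 * (τ * r) * (r ^ 2 * (K * tail)) := by gcongr
    _ = r ^ 2 * (2 * τ * K * (r * tail)) := by ring

lemma lpNorm_centredInfo_comp_sub_clip_centredLocalInfo_le [Finite A] {τ r : ℝ} (hτ : 0 ≤ τ)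
    (hr : 0 ≤ r) {s : Finset (Fin d → ℤ)} (hs : s.card ≤ r ^ 2) (t : Finset (Fin d → ℤ)) :
    lpNorm (centredInfo q t ∘ φ - clip (τ * r) ∘ centredLocalInfo (iidLaw d p) φ q m s) 2
      (iidLaw d p) ≤
      lpNorm (centredInfo q t - clip (τ * r) ∘ centredInfo q s) 2 (iidLaw d q) +
        r * √(2 * τ * K * (r * (codingTail (iidLaw d p) φ m).toReal)) := by
  have hdiff : IsLocal (centredInfo q t - clip (τ * r) ∘ centredInfo q s) :=
    (isLocal_centredInfo q t).sub ((isLocal_centredInfo q s).comp _)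
  calc _ = lpNorm ((centredInfo q t - clip (τ * r) ∘ centredInfo q s) ∘ φ +
        (clip (τ * r) ∘ centredInfo q s ∘ φ -
          clip (τ * r) ∘ centredLocalInfo (iidLaw d p) φ q m s)) 2 (iidLaw d p) := by
        rw [Pi.sub_comp, Function.comp_assoc, sub_add_sub_cancel]
    _ ≤ _ := lpNorm_add_le ((hdiff.memLp _ 2).comp_measurePreserving hφ.measurePreserving)
        one_le_two
    _ ≤ _ := by
        rw [lpNorm_comp_measurePreserving hφ.measurePreserving
          hdiff.measurable.aestronglyMeasurable]
        gcongr
        exact lpNorm_clip_centredInfo_sub_clip_centredLocalInfo_le hφ hK hτ hr hs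

lemma abs_integral_clip_add_clip_mul_le [Fintype A] (hent : entropy p = entropy q) {n : ℕ} {R : ℝ}
    (hR : 0 ≤ R) :
    |∫ x, (clip R ∘ centredInfo p (box d (2 * m) (n - 2 * m)) +
        clip R ∘ centredLocalInfo (iidLaw d p) φ q m (box d (2 * m) (n - 2 * m))) x *
      (centredInfo p (box d 0 n) - centredInfo q (box d 0 n) ∘ φ) x ∂iidLaw d p| ≤
      4 * R * ((box d 0 n).card * (K * (codingTail (iidLaw d p) φ m).toReal)) := by
  have hdep : DependsOn (clip R ∘ centredInfo p (box d (2 * m) (n - 2 * m)) +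
      clip R ∘ centredLocalInfo (iidLaw d p) φ q m (box d (2 * m) (n - 2 * m)))
      (box d m (n - m) : Set (Fin d → ℤ)) := fun x y hxy =>
    congrArg₂ (fun u w => clip R u + clip R w)
      (dependsOn_centredInfo p _ fun v hv =>
        hxy v (box_subset_box (by linarith) (by linarith) hv))
      (dependsOn_centredLocalInfo _ φ q (fun v hv i hi =>
        box_subset_box (by linarith) (by linarith) (add_mem_box_of_mem_cube hi hv)) hxy)
  refine (abs_integral_mul_centredInfo_sub_centredInfo_le hφ hent hdep (b := 2 * R)
    (fun x => ?_) hK).trans_eq (by ring)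
  exact (abs_add_le _ _).trans ((add_le_add (abs_clip_le hR _) (abs_clip_le hR _)).trans_eq
    (two_mul R).symm)

lemma abs_variance_information_sub_le [Fintype A] (hent : entropy p = entropy q) {n : ℕ}
    {r : ℝ} (hr : 0 < r) (hcell : (box d 0 n).card = r ^ 2) {τ ε : ℝ} (hτ : 0 ≤ τ)
    (hp : lpNorm (centredInfo p (box d 0 n) -
      clip (τ * r) ∘ centredInfo p (box d (2 * m) (n - 2 * m))) 2 (iidLaw d p) ≤ ε * r)
    (hq : lpNorm (centredInfo q (box d 0 n) -
      clip (τ * r) ∘ centredInfo q (box d (2 * m) (n - 2 * m))) 2 (iidLaw d q) ≤ ε * r) :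
    |Var[information p; p] - Var[information q; q]| ≤
      (2 * ε + √(2 * τ * K * (r * (codingTail (iidLaw d p) φ m).toReal))) *
        (√Var[information p; p] + √Var[information q; q]) +
      4 * τ * K * (r * (codingTail (iidLaw d p) φ m).toReal) := by
  set tail := (codingTail (iidLaw d p) φ m).toReal
  have hR : 0 ≤ τ * r := by positivity
  have hinner : ((box d (2 * m) (n - 2 * m)).card : ℝ) ≤ r ^ 2 := by
    rw [← hcell]
    exact Nat.cast_le.2 (Finset.card_le_card (box_subset_box (by positivity) (by linarith)))
  have hnormp : lpNorm (centredInfo p (box d 0 n)) 2 (iidLaw d p) = r * √Var[information p; p] := by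
    rw [lpNorm_centredInfo, hcell, Real.sqrt_mul (sq_nonneg r), Real.sqrt_sq hr.le]
  have hnormq : lpNorm (centredInfo q (box d 0 n) ∘ φ) 2 (iidLaw d p) =
      r * √Var[information q; q] := by
    rw [lpNorm_comp_measurePreserving hφ.measurePreserving
      (isLocal_centredInfo q _).measurable.aestronglyMeasurable, lpNorm_centredInfo, hcell,
      Real.sqrt_mul (sq_nonneg r), Real.sqrt_sq hr.le]
  have hdiffq : lpNorm (centredInfo q (box d 0 n) ∘ φ - clip (τ * r) ∘
      centredLocalInfo (iidLaw d p) φ q m (box d (2 * m) (n - 2 * m))) 2 (iidLaw d p) ≤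
      r * (ε + √(2 * τ * K * (r * tail))) := by
    rw [mul_add, mul_comm r ε]
    exact (lpNorm_centredInfo_comp_sub_clip_centredLocalInfo_le hφ hK hτ hr.le hinner _).trans
      (by gcongr)
  have hcorr := abs_integral_clip_add_clip_mul_le (m := m) hφ hK hent (n := n) hR
  have hmain := abs_lpNorm_sq_sub_lpNorm_sq_le
    ((isLocal_centredInfo p (box d 0 n)).memLp (iidLaw d p) 2)
    (((isLocal_centredInfo p (box d (2 * m) (n - 2 * m))).comp (clip (τ * r))).memLp _ 2)
    (((isLocal_centredInfo q (box d 0 n)).memLp _ 2).comp_measurePreserving hφ.measurePreserving)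
    (((isLocal_centredLocalInfo (iidLaw d p) φ q m (box d (2 * m) (n - 2 * m))).comp
      (clip (τ * r))).memLp _ 2)
  rw [hnormp, hnormq, mul_pow, mul_pow, Real.sq_sqrt (variance_nonneg _ _),
    Real.sq_sqrt (variance_nonneg _ _), ← mul_sub, abs_mul, abs_of_nonneg (sq_nonneg r)] at hmain
  refine le_of_mul_le_mul_left (hmain.trans ?_) (pow_pos hr 2)
  rw [hcell] at hcorr
  calc _ ≤ (ε * r + r * (ε + √(2 * τ * K * (r * tail)))) *
        (r * √Var[information p; p] + r * √Var[information q; q]) +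
        4 * (τ * r) * (r ^ 2 * (K * tail)) := by gcongr; exacts [hp, hdiffq, hcorr]
    _ = _ := by ring

end FixedScale

section Limit

variable {d : ℕ} {A B : Type*} [Fintype A] [MeasurableSpace A] [MeasurableSingletonClass A]
  [Fintype B] [MeasurableSpace B] [MeasurableSingletonClass B]
  {p : Measure A} [IsProbabilityMeasure p] {q : Measure B} [IsProbabilityMeasure q]
  {φ : Config d A → Config d B} (hφ : IsFactorMap (iidLaw d p) (iidLaw d q) φ)
include hφ

lemma exists_abs_variance_information_sub_le (hent : entropy p = entropy q) {ε : ℝ}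
    (hε : 0 < ε) :
    ∃ C D : ℝ, ∀ m : ℕ, 0 < m →
      |Var[information p; p] - Var[information q; q]| ≤
        (2 * ε + √(C * ((m : ℝ≥0∞) ^ ((d : ℝ) / 2) * codingTail (iidLaw d p) φ m).toReal)) *
          (√Var[information p; p] + √Var[information q; q]) +
        D * ((m : ℝ≥0∞) ^ ((d : ℝ) / 2) * codingTail (iidLaw d p) φ m).toReal := by
  obtain ⟨K, hK⟩ := exists_information_le q
  obtain ⟨k, hkp, hkq, hk⟩ := ((eventually_lpNorm_centredInfo_sub_clip_le (d := d) p hε).and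
    ((eventually_lpNorm_centredInfo_sub_clip_le (d := d) q hε).and
      (eventually_gt_atTop 0))).exists
  refine ⟨2 * k * K * √((k : ℝ) ^ d), 4 * k * K * √((k : ℝ) ^ d), fun m hm => ?_⟩
  have hscale : √(((k * m : ℕ) : ℝ) ^ d) * (codingTail (iidLaw d p) φ m).toReal =
      √((k : ℝ) ^ d) *
        ((m : ℝ≥0∞) ^ ((d : ℝ) / 2) * codingTail (iidLaw d p) φ m).toReal := by
    rw [ENNReal.toReal_mul, ← ENNReal.toReal_rpow, ENNReal.toReal_natCast, Nat.cast_mul, mul_pow,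
      Real.sqrt_mul (by positivity), Real.sqrt_eq_rpow ((m : ℝ) ^ d),
      ← Real.rpow_natCast_mul m.cast_nonneg, mul_one_div, mul_assoc]
  have hcell : ((box d 0 (k * m : ℕ)).card : ℝ) = √(((k * m : ℕ) : ℝ) ^ d) ^ 2 := by
    rw [Real.sq_sqrt (by positivity), card_box (by positivity), Int.cast_zero, sub_zero,
      Int.cast_natCast]
  have hfixed := abs_variance_information_sub_le hφ hK hent (by positivity) hcell k.cast_nonneg
    (hkp m hm _ rfl) (hkq m hm _ rfl)
  rwa [hscale, ← mul_assoc, ← mul_assoc] at hfixed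

theorem variance_information_eq (hent : entropy p = entropy q)
    (htail : liminf (fun m : ℕ => (m : ℝ≥0∞) ^ ((d : ℝ) / 2) * codingTail (iidLaw d p) φ m)
      atTop = 0) :
    Var[information p; p] = Var[information q; q] := by
  set w : ℕ → ℝ≥0∞ := fun m => (m : ℝ≥0∞) ^ ((d : ℝ) / 2) * codingTail (iidLaw d p) φ m
  set S := √Var[information p; p] + √Var[information q; q]
  obtain ⟨u, hwu, hu⟩ := exists_seq_tendsto_liminf (f := atTop) (u := w)
  rw [htail] at hwu
  have hw : Tendsto (fun i => (w (u i)).toReal) atTop (𝓝 0) :=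
    (ENNReal.tendsto_toReal ENNReal.zero_ne_top).comp hwu
  have hbound : ∀ ε > 0, |Var[information p; p] - Var[information q; q]| ≤ 2 * ε * S := by
    intro ε hε
    obtain ⟨C, D, hCD⟩ := exists_abs_variance_information_sub_le hφ hent hε
    have hlim : Tendsto (fun i => (2 * ε + √(C * (w (u i)).toReal)) * S + D * (w (u i)).toReal)
        atTop (𝓝 ((2 * ε + √(C * 0)) * S + D * 0)) :=
      (((hw.const_mul C).sqrt.const_add _).mul_const S).add (hw.const_mul D)
    rw [mul_zero, mul_zero, Real.sqrt_zero, add_zero, add_zero] at hlim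
    exact ge_of_tendsto hlim
      ((hu.eventually_gt_atTop 0).mono fun i hi => hCD (u i) hi)
  have hzero : Tendsto (fun ε : ℝ => 2 * ε * S) (𝓝[>] 0) (𝓝 (2 * 0 * S)) :=
    ((tendsto_id.const_mul 2).mul_const S).mono_left nhdsWithin_le_nhds
  rw [mul_zero, zero_mul] at hzero
  exact sub_eq_zero.1 (abs_nonpos_iff.1
    (ge_of_tendsto hzero (eventually_mem_nhdsWithin.mono fun ε hε => hbound ε hε)))

end Limit

end FinitaryFactor

end

theorem theorem1_general {A B : Type*}
    [Fintype A] [MeasurableSpace A] [MeasurableSingletonClass A]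
    [Fintype B] [MeasurableSpace B] [MeasurableSingletonClass B] (d : ℕ)
    (p : Measure A) [IsProbabilityMeasure p] (q : Measure B) [IsProbabilityMeasure q]
    (hent : FinitaryFactor.entropy p = FinitaryFactor.entropy q)
    (φ : FinitaryFactor.Config d A → FinitaryFactor.Config d B)
    (hφ : FinitaryFactor.IsFactorMap (FinitaryFactor.iidLaw d p) (FinitaryFactor.iidLaw d q) φ)
    (htail : Filter.liminf (fun m : ℕ => (m : ℝ≥0∞) ^ ((d : ℝ) / 2) *
      FinitaryFactor.codingTail (FinitaryFactor.iidLaw d p) φ m) Filter.atTop = 0) :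
    variance (fun x => FinitaryFactor.information p (x 0)) (FinitaryFactor.iidLaw d p) =
      variance (fun y => FinitaryFactor.information q (y 0)) (FinitaryFactor.iidLaw d q) := by
  rw [FinitaryFactor.variance_information_apply, FinitaryFactor.variance_information_apply,
    FinitaryFactor.variance_information_eq hφ hent htail]

theorem theorem1 {A B : Type*}
    [Fintype A] [MeasurableSpace A] [MeasurableSingletonClass A]
    [Fintype B] [MeasurableSpace B] [MeasurableSingletonClass B]
    (d : ℕ) (hd : 0 < d)
    (p : Measure A) [IsProbabilityMeasure p] (q : Measure B) [IsProbabilityMeasure q]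
    (hent : FinitaryFactor.entropy p = FinitaryFactor.entropy q)
    (φ : FinitaryFactor.Config d A → FinitaryFactor.Config d B)
    (hφ : FinitaryFactor.IsFactorMap (FinitaryFactor.iidLaw d p) (FinitaryFactor.iidLaw d q) φ)
    (hfin : FinitaryFactor.IsFinitary (FinitaryFactor.iidLaw d p) φ)
    (hmom : FinitaryFactor.codingMoment (FinitaryFactor.iidLaw d p) φ ((d : ℝ) / 2) < ⊤) :
    variance (fun x => FinitaryFactor.information p (x 0)) (FinitaryFactor.iidLaw d p) =
      variance (fun y => FinitaryFactor.information q (y 0)) (FinitaryFactor.iidLaw d q) :=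
  theorem1_general d p q hent φ hφ (FinitaryFactor.tendsto_rpow_mul_codingTail
    hφ.measurePreserving.measurable hfin (by positivity) hmom.ne).liminf_eq
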